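/- **Setting.** Let $\mathcal C$ be a bicategory. For morphisms $a,b,c$ for which $a\circ(b\circ c)$ is defined let $\theta_{a,b,c}:a\circ(b\circ c)\Rightarrow(a\circ b)\circ c$ be the associator, and for $a:A\to B$ let $\pi_a:a\circ\mathrm{id}_A\Rightarrow a$ and $\upsilon_a:\mathrm{id}_B\circ a\Rightarrow a$ be the unitors. Let $W$ be a class of morphisms of $\mathcal C$ such that $(\mathcal C,W)$ admits a (right) bicalculus of fractions (up to associators of $\mathcal C$, which are left implicit in the rest of the setting): * (BF1) $\mathrm{id}_A\in W$ for all $A$. (BF2) $W$ is closed under composition. * (BF3) For $s:Y\to B$ in $W$ and $f:X\to B$ there are $s':Z\to X$ in $W$, $f':Z\to Y$ and an invertible $2$-morphism $f\circ s'\Rightarrow s\circ f'$. * (BF4) For $s:B\to A$ in $W$, $f^1,f^2:X\to B$ and $\varphi:s\circ f^1\Rightarrow s\circ f^2$ there are $t:Z\to X$ in $W$ and $\beta:f^1\circ t\Rightarrow f^2\circ t$ with $\varphi\circ t=s\circ\beta$, where $\beta$ is invertible if $\varphi$ is; and for any other pair $(t',\beta')$ with $t'\in W$ and $\varphi\circ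 t'=s\circ\beta'$ there are morphisms $r,r'$ and an invertible $\zeta:t\circ r\Rightarrow t'\circ r'$ such that $t\circ r\in W$ and $(\beta'\circ r')\cdot(f^1\circ\zeta)=(f^2\circ\zeta)\cdot(\beta\circ r)$. * (BF5) If $s\in W$ and there is an invertible $2$-morphism $s'\Rightarrow s$, then $s'\in W$. Fix a set of choices $\mathrm C(W)$: for each $f:X\to B$ and each $s:Y\to B$ in $W$ a quadruple $(Z,s',f',\rho)$ with $s':Z\to X$ in $W$, $f':Z\to Y$ and $\rho:f\circ s'\Rightarrow s\circ f'$ invertible. As usual, assume that for every $f:X\to B$ the choice for $(f,\mathrm{id}_B)$ is $(X,\mathrm{id}_X,f,\upsilon_f^{-1}\cdot\pi_f)$. The bicategory of fractions $\mathcal C[W^{-1}]$ has the objects of $\mathcal C$. A morphism $A\to B$ is a triple $(A',u,f)$ with $u:A'\to A$ in $W$ and $f:A'\to B$; one puts $(B',v,g)\circ(A',u,f)=(Z,u\circ v',g\circ f')$, where $(Z,v',f',\rho)$ is the choice for $(f,v)$. A $2$-morphism $(A^1,w^1,f^1)\Rightarrow(A^2,w^2,f^2)$ between morphisms $A\to B$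 is a class $[A^3,v^1,v^2,\alpha,\beta]$ with $v^m:A^3\to A^m$, $w^1\circ v^1\in W$, $\alpha:w^1\circ v^1\Rightarrow w^2\circ v^2$ invertible and $\beta:f^1\circ v^1\Rightarrow f^2\circ v^2$. Data $(A^3,v^1,v^2,\alpha,\beta)$ and $(A'^3,v'^1,v'^2,\alpha',\beta')$ represent the same $2$-morphism iff there are $z:A^4\to A^3$, $z':A^4\to A'^3$ with $w^1\circ v^1\circ z\in W$ and invertible $\sigma^1:v'^1\circ z'\Rightarrow v^1\circ z$, $\sigma^2:v^2\circ z\Rightarrow v'^2\circ z'$ such that $\alpha'\circ z'=(w^2\circ\sigma^2)\cdot(\alpha\circ z)\cdot(w^1\circ\sigma^1)$ and $\beta'\circ z'=(f^2\circ\sigma^2)\cdot(\beta\circ z)\cdot(f^1\circ\sigma^1)$. The associator $\Theta_{\underline h,\underline g,\underline f}:\underline h\circ(\underline g\circ\underline f)\Rightarrow(\underline h\circ\underline g)\circ\underline f$ for $\underline f=(A',u,f)$, $\underline g=(B',v,g)$, $\underline h=(C',w,h)$ is obtained as follows. Let $(A^1,u^1,f^1,\delta)$, $(A^2,u^2,l,\sigma)$,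 $(B^2,v^1,g^1,\xi)$, $(A^3,u^3,f^2,\eta)$ be the choices for $(f,v)$, $(g\circ f^1,w)$, $(g,w)$, $(f,v\circ v^1)$. Take data $(A^4,u^4,u^5,\gamma,\omega,\rho)$ consisting of $u^4:A^4\to A^2$ with $u\circ u^1\circ u^2\circ u^4\in W$, $u^5:A^4\to A^3$ and invertible $2$-morphisms $\gamma:u^1\circ u^2\circ u^4\Rightarrow u^3\circ u^5$, $\omega:f^1\circ u^2\circ u^4\Rightarrow v^1\circ f^2\circ u^5$, $\rho:l\circ u^4\Rightarrow g^1\circ f^2\circ u^5$ such that $$v\circ\omega=(\eta\circ u^5)\cdot(f\circ\gamma)\cdot(\delta^{-1}\circ u^2\circ u^4),\qquad w\circ\rho=(\xi\circ f^2\circ u^5)\cdot(g\circ\omega)\cdot(\sigma^{-1}\circ u^4).$$ Then $\Theta_{\underline h,\underline g,\underline f}=[A^4,u^4,u^5,u\circ\gamma,h\circ\rho]$. Such data can be obtained by taking the choice in $\mathrm C(W)$ for $(u^1\circ u^2,u^3)$ and then, from a set of choices $\mathrm D(W)$ of pairs $(t,\beta)$ as in (BF4) for all $(s,f^1,f^2,\varphi)$,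 with $\beta$ invertible if $\varphi$ is, the lift along $v$ and then the lift along $w$. **Statement.** Let $\underline f=(A',u,f):A\to B$, $\underline g=(B,\mathrm{id}_B,g):B\to C$ and $\underline h=(C,\mathrm{id}_C,h):C\to D$ be morphisms of $\mathcal C[W^{-1}]$, and let $(A^3,u^3,f^2,\eta)$ be the choice in $\mathrm C(W)$ for the pair $(f,\mathrm{id}_B\circ\mathrm{id}_B)$, so that $u^3:A^3\to A'$ is in $W$, $f^2:A^3\to B$, and $\eta:f\circ u^3\Rightarrow(\mathrm{id}_B\circ\mathrm{id}_B)\circ f^2$ is invertible. Then $$\underline h\circ(\underline g\circ\underline f)=\bigl(A',\,(u\circ\mathrm{id}_{A'})\circ\mathrm{id}_{A'},\,h\circ(g\circ f)\bigr),\qquad(\underline h\circ\underline g)\circ\underline f=\bigl(A^3,\,u\circ u^3,\,(h\circ g)\circ f^2\bigr),$$ and the associator from the first to the second is $$\Theta_{\underline h,\underline g,\underline f}=\bigl[A^3,\,u^3,\,\mathrm{id}_{A^3},\,\alpha,\,\beta\bigr],$$ whichever auxiliary data $(A^4,u^4,u^5,\gamma,\omega,\rho)$ (in particular, those given by any $\mathrm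 D(W)$) are used to compute it. Here $\alpha:((u\circ\mathrm{id}_{A'})\circ\mathrm{id}_{A'})\circ u^3\Rightarrow(u\circ u^3)\circ\mathrm{id}_{A^3}$ and $\beta:(h\circ(g\circ f))\circ u^3\Rightarrow((h\circ g)\circ f^2)\circ\mathrm{id}_{A^3}$ are $$\alpha=\pi_{u\circ u^3}^{-1}\cdot(\pi_u\circ u^3)\cdot\bigl((\pi_u\circ\mathrm{id}_{A'})\circ u^3\bigr),$$ $$\beta=\pi_{(h\circ g)\circ f^2}^{-1}\cdot\bigl((h\circ g)\circ\upsilon_{f^2}\bigr)\cdot\bigl((h\circ g)\circ(\upsilon_{\mathrm{id}_B}\circ f^2)\bigr)\cdot\bigl((h\circ g)\circ\eta\bigr)\cdot\theta_{h\circ g,f,u^3}^{-1}\cdot(\theta_{h,g,f}\circ u^3).$$ -/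

import Mathlib

open CategoryTheory Bicategory

universe w v u

namespace FracBicat

/-! Composition is written in diagrammatic order: `f ≫ g` is the composite usually denoted
`g ∘ f`.  Accordingly, for 1-morphisms `a, b, c` with `a ∘ (b ∘ c)` defined, the associator
`a ∘ (b ∘ c) ⟹ (a ∘ b) ∘ c` is `(α_ c b a).hom`, the right unitor `a ∘ id ⟹ a` is `(λ_ a).hom`
and the left unitor `id ∘ a ⟹ a` is `(ρ_ a).hom`. -/

section Axioms

variable {C : Type u} [Bicategory.{w, v} C] (W : MorphismProperty C)

/-- A filling of the cospan `X --f--> B <--s-- Y` by a square with an invertible 2-morphism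
`f ∘ leg ⟹ s ∘ top`, such that `leg` belongs to `W`. -/
structure Square {X B Y : C} (f : X ⟶ B) (s : Y ⟶ B) where
  obj : C
  leg : obj ⟶ X
  leg_mem : W leg
  top : obj ⟶ Y
  cell : leg ≫ f ≅ top ≫ s

/-- For a 2-morphism `φ : s ∘ f₁ ⟹ s ∘ f₂`: a morphism `leg` in `W` and a 2-morphism
`cell : f₁ ∘ leg ⟹ f₂ ∘ leg` such that `φ ∘ leg = s ∘ cell`. -/
structure Lift {X B A : C} (s : B ⟶ A) {f₁ f₂ : X ⟶ B} (φ : f₁ ≫ s ⟶ f₂ ≫ s) where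
  obj : C
  leg : obj ⟶ X
  leg_mem : W leg
  cell : leg ≫ f₁ ⟶ leg ≫ f₂
  eq : (α_ leg f₁ s).hom ≫ leg ◁ φ = cell ▷ s ≫ (α_ leg f₂ s).hom

/-- The pair `(C, W)` admits a (right) bicalculus of fractions. -/
structure IsBicalculus : Prop where
  /-- (BF1) -/
  id_mem (A : C) : W (𝟙 A)
  /-- (BF2) -/
  comp_mem {X Y Z : C} (f : X ⟶ Y) (g : Y ⟶ Z) : W f → W g → W (f ≫ g)
  /-- (BF3) -/
  exists_square {X B Y : C} (f : X ⟶ B) (s : Y ⟶ B) : W s → Nonempty (Square W f s)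
  /-- (BF4): existence of a lift (a), which is invertible if `φ` is (b), and which can be compared
  with every other lift (c). -/
  exists_lift {X B A : C} (s : B ⟶ A) (_ : W s) (f₁ f₂ : X ⟶ B) (φ : f₁ ≫ s ⟶ f₂ ≫ s) :
    ∃ L : Lift W s φ, (IsIso φ → IsIso L.cell) ∧
      ∀ L' : Lift W s φ, ∃ (E : C) (t : E ⟶ L.obj) (t' : E ⟶ L'.obj)
        (ζ : t ≫ L.leg ≅ t' ≫ L'.leg), W (t ≫ L.leg) ∧
          (α_ t L.leg f₁).inv ≫ ζ.hom ▷ f₁ ≫ (α_ t' L'.leg f₁).hom ≫ t' ◁ L'.cell =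
            t ◁ L.cell ≫ (α_ t L.leg f₂).inv ≫ ζ.hom ▷ f₂ ≫ (α_ t' L'.leg f₂).hom
  /-- (BF5) -/
  iso_mem {X Y : C} (f g : X ⟶ Y) : W g → Nonempty (f ≅ g) → W f

/-- A set of choices `C(W)`: a square for every pair `(f, s)` with `s` in `W`. -/
structure SquareChoices where
  square {X B Y : C} (f : X ⟶ B) (s : Y ⟶ B) (hs : W s) : Square W f s

/-- A set of choices `D(W)`: a lift for every `φ : s ∘ f₁ ⟹ s ∘ f₂` with `s` in `W`,
invertible if `φ` is invertible. -/
structure LiftChoices where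
  lift {X B A : C} (s : B ⟶ A) (hs : W s) {f₁ f₂ : X ⟶ B} (φ : f₁ ≫ s ⟶ f₂ ≫ s) : Lift W s φ
  isIso_cell {X B A : C} (s : B ⟶ A) (hs : W s) {f₁ f₂ : X ⟶ B} (φ : f₁ ≫ s ⟶ f₂ ≫ s)
    [IsIso φ] : IsIso (lift s hs φ).cell

variable {W}

/-- The convention on `C(W)` for pairs `(f, id_B)`: the chosen square has vertex the source `X`
of `f`, legs `id_X` and `f`, and 2-morphism `f ∘ id_X ⟹ f ⟹ id_B ∘ f` composed of unitors. -/
def SquareChoices.IsUnital (H : IsBicalculus W) (Ch : SquareChoices W) : Prop :=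
  ∀ {X B : C} (f : X ⟶ B),
    Ch.square f (𝟙 B) (H.id_mem B) = ⟨X, 𝟙 X, H.id_mem X, f, λ_ f ≪≫ (ρ_ f).symm⟩

end Axioms

section Fractions

variable {C : Type u} [Bicategory.{w, v} C] (W : MorphismProperty C)

/-- A 1-morphism `A ⟶ B` of the bicategory of fractions: a triple `(obj, den, num)`. -/
structure Frac (A B : C) where
  obj : C
  den : obj ⟶ A
  den_mem : W den
  num : obj ⟶ B

variable {W}

/-- The composite of `f` and then `g` (usually denoted `g ∘ f`) determined by `C(W)`. -/
def Frac.comp (H : IsBicalculus W) (Ch : SquareChoices W) {A B D : C}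
    (f : Frac W A B) (g : Frac W B D) : Frac W A D where
  obj := (Ch.square f.num g.den g.den_mem).obj
  den := (Ch.square f.num g.den g.den_mem).leg ≫ f.den
  den_mem := H.comp_mem _ _ (Ch.square f.num g.den g.den_mem).leg_mem f.den_mem
  num := (Ch.square f.num g.den g.den_mem).top ≫ g.num

/-- Data `(obj, v₁, v₂, α, β)` representing a 2-morphism of the bicategory of fractions. -/
structure PreCell {A B : C} (f₁ f₂ : Frac W A B) where
  obj : C
  v₁ : obj ⟶ f₁.obj
  v₂ : obj ⟶ f₂.obj
  mem : W (v₁ ≫ f₁.den)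
  α : v₁ ≫ f₁.den ≅ v₂ ≫ f₂.den
  β : v₁ ≫ f₁.num ⟶ v₂ ≫ f₂.num

/-- Two sets of data are related if they represent the same 2-morphism. -/
def PreCell.Rel {A B : C} {f₁ f₂ : Frac W A B} (d d' : PreCell f₁ f₂) : Prop :=
  ∃ (E : C) (z : E ⟶ d.obj) (z' : E ⟶ d'.obj)
    (σ₁ : z' ≫ d'.v₁ ≅ z ≫ d.v₁) (σ₂ : z ≫ d.v₂ ≅ z' ≫ d'.v₂),
    W (z ≫ d.v₁ ≫ f₁.den) ∧
    (α_ z' d'.v₁ f₁.den).inv ≫ σ₁.hom ▷ f₁.den ≫ (α_ z d.v₁ f₁.den).hom ≫ z ◁ d.α.hom ≫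
        (α_ z d.v₂ f₂.den).inv ≫ σ₂.hom ▷ f₂.den ≫ (α_ z' d'.v₂ f₂.den).hom =
      z' ◁ d'.α.hom ∧
    (α_ z' d'.v₁ f₁.num).inv ≫ σ₁.hom ▷ f₁.num ≫ (α_ z d.v₁ f₁.num).hom ≫ z ◁ d.β ≫
        (α_ z d.v₂ f₂.num).inv ≫ σ₂.hom ▷ f₂.num ≫ (α_ z' d'.v₂ f₂.num).hom =
      z' ◁ d'.β

/-- The 2-morphisms `f₁ ⟹ f₂` of the bicategory of fractions: classes of data
`(obj, v₁, v₂, α, β)`. -/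
def Cell {A B : C} (f₁ f₂ : Frac W A B) : Type (max u v w) :=
  Quot (PreCell.Rel (f₁ := f₁) (f₂ := f₂))

/-- The class of a set of data. -/
def PreCell.toCell {A B : C} {f₁ f₂ : Frac W A B} (d : PreCell f₁ f₂) : Cell f₁ f₂ :=
  Quot.mk _ d

/-- A 2-morphism `f₁ ⟹ f₂` regarded as one `f₁' ⟹ f₂'` when `f₁ = f₁'` and `f₂ = f₂'`. -/
def Cell.cast {A B : C} {f₁ f₂ f₁' f₂' : Frac W A B} (e₁ : f₁ = f₁') (e₂ : f₂ = f₂')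
    (Γ : Cell f₁ f₂) : Cell f₁' f₂' :=
  e₁ ▸ e₂ ▸ Γ

end Fractions

section Pasting

variable {C : Type u} [Bicategory.{w, v} C]

/-- The pasting of `δ⁻¹`, `γ` and `η`, as an invertible 2-morphism
`v ∘ (f¹ ∘ u² ∘ u⁴) ⟹ v ∘ (v¹ ∘ f² ∘ u⁵)`. -/
def pastingOne {A' B B' A₁ A₂ A₃ B₂ X : C} {f : A' ⟶ B} {v : B' ⟶ B} {u₁ : A₁ ⟶ A'}
    {f₁ : A₁ ⟶ B'} (δ : u₁ ≫ f ≅ f₁ ≫ v) {u₂ : A₂ ⟶ A₁} {v₁ : B₂ ⟶ B'} {u₃ : A₃ ⟶ A'}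
    {f₂ : A₃ ⟶ B₂} (η : u₃ ≫ f ≅ f₂ ≫ v₁ ≫ v) {u₄ : X ⟶ A₂} {u₅ : X ⟶ A₃}
    (γ : u₄ ≫ u₂ ≫ u₁ ≅ u₅ ≫ u₃) :
    (u₄ ≫ u₂ ≫ f₁) ≫ v ≅ (u₅ ≫ f₂ ≫ v₁) ≫ v :=
  α_ u₄ (u₂ ≫ f₁) v ≪≫ whiskerLeftIso u₄ (α_ u₂ f₁ v) ≪≫
    whiskerLeftIso u₄ (whiskerLeftIso u₂ δ.symm) ≪≫
    whiskerLeftIso u₄ (α_ u₂ u₁ f).symm ≪≫ (α_ u₄ (u₂ ≫ u₁) f).symm ≪≫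
    whiskerRightIso γ f ≪≫ α_ u₅ u₃ f ≪≫ whiskerLeftIso u₅ η ≪≫
    whiskerLeftIso u₅ (α_ f₂ v₁ v).symm ≪≫ (α_ u₅ (f₂ ≫ v₁) v).symm

/-- The pasting of `σ⁻¹`, `ω` and `ξ`, as an invertible 2-morphism
`w ∘ (l ∘ u⁴) ⟹ w ∘ (g¹ ∘ f² ∘ u⁵)`. -/
def pastingTwo {B' D C' A₁ A₂ A₃ B₂ X : C} {g : B' ⟶ D} {w : C' ⟶ D} {f₁ : A₁ ⟶ B'}
    {u₂ : A₂ ⟶ A₁} {l : A₂ ⟶ C'} (σ : u₂ ≫ f₁ ≫ g ≅ l ≫ w) {v₁ : B₂ ⟶ B'} {g₁ : B₂ ⟶ C'}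
    (ξ : v₁ ≫ g ≅ g₁ ≫ w) {f₂ : A₃ ⟶ B₂} {u₄ : X ⟶ A₂} {u₅ : X ⟶ A₃}
    (ω : u₄ ≫ u₂ ≫ f₁ ≅ u₅ ≫ f₂ ≫ v₁) :
    (u₄ ≫ l) ≫ w ≅ (u₅ ≫ f₂ ≫ g₁) ≫ w :=
  α_ u₄ l w ≪≫ whiskerLeftIso u₄ σ.symm ≪≫
    whiskerLeftIso u₄ (α_ u₂ f₁ g).symm ≪≫ (α_ u₄ (u₂ ≫ f₁) g).symm ≪≫
    whiskerRightIso ω g ≪≫ α_ u₅ (f₂ ≫ v₁) g ≪≫ whiskerLeftIso u₅ (α_ f₂ v₁ g) ≪≫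
    whiskerLeftIso u₅ (whiskerLeftIso f₂ ξ) ≪≫
    whiskerLeftIso u₅ (α_ f₂ g₁ w).symm ≪≫ (α_ u₅ (f₂ ≫ g₁) w).symm

/-- Restriction of an invertible 2-morphism `b ∘ a ⟹ d ∘ c` along `z`. -/
def restrict {X Y Y' T Z : C} (z : Z ⟶ X) {a : X ⟶ Y} {b : Y ⟶ T} {c : X ⟶ Y'} {d : Y' ⟶ T}
    (θ : a ≫ b ≅ c ≫ d) : (z ≫ a) ≫ b ≅ (z ≫ c) ≫ d :=
  α_ z a b ≪≫ whiskerLeftIso z θ ≪≫ (α_ z c d).symm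

lemma pastingOne_restrict {A' B B' A₁ A₂ A₃ B₂ X Z : C} {f : A' ⟶ B} {v : B' ⟶ B}
    {u₁ : A₁ ⟶ A'} {f₁ : A₁ ⟶ B'} (δ : u₁ ≫ f ≅ f₁ ≫ v) {u₂ : A₂ ⟶ A₁} {v₁ : B₂ ⟶ B'}
    {u₃ : A₃ ⟶ A'} {f₂ : A₃ ⟶ B₂} (η : u₃ ≫ f ≅ f₂ ≫ v₁ ≫ v) {u₄ : X ⟶ A₂} {u₅ : X ⟶ A₃}
    (γ : u₄ ≫ u₂ ≫ u₁ ≅ u₅ ≫ u₃) (z : Z ⟶ X) :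
    (pastingOne δ η (restrict z γ)).hom =
      (α_ z u₄ (u₂ ≫ f₁)).hom ▷ v ≫ (α_ z (u₄ ≫ u₂ ≫ f₁) v).hom ≫
        z ◁ (pastingOne δ η γ).hom ≫
        (α_ z (u₅ ≫ f₂ ≫ v₁) v).inv ≫ (α_ z u₅ (f₂ ≫ v₁)).inv ▷ v := by
  simp [pastingOne, restrict]

lemma pastingTwo_restrict {B' D C' A₁ A₂ A₃ B₂ X Z : C} {g : B' ⟶ D} {w : C' ⟶ D}
    {f₁ : A₁ ⟶ B'} {u₂ : A₂ ⟶ A₁} {l : A₂ ⟶ C'} (σ : u₂ ≫ f₁ ≫ g ≅ l ≫ w) {v₁ : B₂ ⟶ B'}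
    {g₁ : B₂ ⟶ C'} (ξ : v₁ ≫ g ≅ g₁ ≫ w) {f₂ : A₃ ⟶ B₂} {u₄ : X ⟶ A₂} {u₅ : X ⟶ A₃}
    (ω : u₄ ≫ u₂ ≫ f₁ ≅ u₅ ≫ f₂ ≫ v₁) (z : Z ⟶ X) :
    (pastingTwo σ ξ (restrict z ω)).hom =
      (α_ z u₄ l).hom ▷ w ≫ (α_ z (u₄ ≫ l) w).hom ≫
        z ◁ (pastingTwo σ ξ ω).hom ≫
        (α_ z (u₅ ≫ f₂ ≫ g₁) w).inv ≫ (α_ z u₅ (f₂ ≫ g₁)).inv ▷ w := by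
  simp [pastingTwo, restrict]

lemma restrict_pastingOne {A' B B' A₁ A₂ A₃ B₂ X Z : C} {f : A' ⟶ B} {v : B' ⟶ B}
    {u₁ : A₁ ⟶ A'} {f₁ : A₁ ⟶ B'} (δ : u₁ ≫ f ≅ f₁ ≫ v) {u₂ : A₂ ⟶ A₁} {v₁ : B₂ ⟶ B'}
    {u₃ : A₃ ⟶ A'} {f₂ : A₃ ⟶ B₂} (η : u₃ ≫ f ≅ f₂ ≫ v₁ ≫ v) {u₄ : X ⟶ A₂} {u₅ : X ⟶ A₃}
    (γ : u₄ ≫ u₂ ≫ u₁ ≅ u₅ ≫ u₃) (ω : u₄ ≫ u₂ ≫ f₁ ≅ u₅ ≫ f₂ ≫ v₁)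
    (hω : ω.hom ▷ v = (pastingOne δ η γ).hom) (z : Z ⟶ X) :
    (restrict z ω).hom ▷ v = (pastingOne δ η (restrict z γ)).hom := by
  rw [pastingOne_restrict, ← hω]
  simp [restrict]

/-- Reassociation of an invertible 2-morphism. -/
def reassociate {X Y Y' T Z : C} (z : Z ⟶ X) {a : X ⟶ Y} {b : Y ⟶ T} {c : X ⟶ Y'} {d : Y' ⟶ T}
    (θ : z ≫ a ≫ b ≅ z ≫ c ≫ d) : (z ≫ a) ≫ b ≅ (z ≫ c) ≫ d :=
  α_ z a b ≪≫ θ ≪≫ (α_ z c d).symm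

lemma reassociate_pastingOne {A' B B' A₁ A₂ A₃ B₂ X Z : C} {f : A' ⟶ B} {v : B' ⟶ B}
    {u₁ : A₁ ⟶ A'} {f₁ : A₁ ⟶ B'} (δ : u₁ ≫ f ≅ f₁ ≫ v) {u₂ : A₂ ⟶ A₁} {v₁ : B₂ ⟶ B'}
    {u₃ : A₃ ⟶ A'} {f₂ : A₃ ⟶ B₂} (η : u₃ ≫ f ≅ f₂ ≫ v₁ ≫ v) {u₄ : X ⟶ A₂} {u₅ : X ⟶ A₃}
    (γ : u₄ ≫ u₂ ≫ u₁ ≅ u₅ ≫ u₃) (z : Z ⟶ X) (θ : z ≫ u₄ ≫ u₂ ≫ f₁ ≅ z ≫ u₅ ≫ f₂ ≫ v₁)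
    (hθ : (α_ z (u₄ ≫ u₂ ≫ f₁) v).hom ≫ z ◁ (pastingOne δ η γ).hom =
      θ.hom ▷ v ≫ (α_ z (u₅ ≫ f₂ ≫ v₁) v).hom) :
    (reassociate z θ).hom ▷ v = (pastingOne δ η (restrict z γ)).hom := by
  rw [pastingOne_restrict, reassoc_of% hθ]
  simp [reassociate]

lemma reassociate_pastingTwo {B' D C' A₁ A₂ A₃ B₂ X Z : C} {g : B' ⟶ D} {w : C' ⟶ D}
    {f₁ : A₁ ⟶ B'} {u₂ : A₂ ⟶ A₁} {l : A₂ ⟶ C'} (σ : u₂ ≫ f₁ ≫ g ≅ l ≫ w) {v₁ : B₂ ⟶ B'}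
    {g₁ : B₂ ⟶ C'} (ξ : v₁ ≫ g ≅ g₁ ≫ w) {f₂ : A₃ ⟶ B₂} {u₄ : X ⟶ A₂} {u₅ : X ⟶ A₃}
    (ω : u₄ ≫ u₂ ≫ f₁ ≅ u₅ ≫ f₂ ≫ v₁) (z : Z ⟶ X) (θ : z ≫ u₄ ≫ l ≅ z ≫ u₅ ≫ f₂ ≫ g₁)
    (hθ : (α_ z (u₄ ≫ l) w).hom ≫ z ◁ (pastingTwo σ ξ ω).hom =
      θ.hom ▷ w ≫ (α_ z (u₅ ≫ f₂ ≫ g₁) w).hom) :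
    (reassociate z θ).hom ▷ w = (pastingTwo σ ξ (restrict z ω)).hom := by
  rw [pastingTwo_restrict, reassoc_of% hθ]
  simp [reassociate]

end Pasting

section Associator

variable {C : Type u} [Bicategory.{w, v} C] {W : MorphismProperty C} (H : IsBicalculus W)
  (Ch : SquareChoices W) {A B D E : C} (f : Frac W A B) (g : Frac W B D) (h : Frac W D E)

/-- The chosen square `(A¹, u¹, f¹, δ)`, used for `g ∘ f`. -/
def squareGF : Square W f.num g.den := Ch.square f.num g.den g.den_mem

/-- The chosen square `(A², u², l, σ)`, used for `h ∘ (g ∘ f)`. -/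
def squareH_GF : Square W ((squareGF Ch f g).top ≫ g.num) h.den :=
  Ch.square ((squareGF Ch f g).top ≫ g.num) h.den h.den_mem

/-- The chosen square `(A³, u³, f², η)`, used for `(h ∘ g) ∘ f`; the chosen square
`(B², v¹, g¹, ξ)` used for `h ∘ g` is `squareGF Ch g h`. -/
def squareHG_F : Square W f.num ((squareGF Ch g h).leg ≫ g.den) :=
  Ch.square f.num ((squareGF Ch g h).leg ≫ g.den)
    (H.comp_mem _ _ (squareGF Ch g h).leg_mem g.den_mem)

/-- The data `(A⁴, u⁴, u⁵, γ, ω, ρ)` from which the associator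
`h ∘ (g ∘ f) ⟹ (h ∘ g) ∘ f` is computed. -/
structure AssocData where
  obj : C
  u₄ : obj ⟶ (squareH_GF Ch f g h).obj
  mem : W (u₄ ≫ (squareH_GF Ch f g h).leg ≫ (squareGF Ch f g).leg ≫ f.den)
  u₅ : obj ⟶ (squareHG_F H Ch f g h).obj
  γ : u₄ ≫ (squareH_GF Ch f g h).leg ≫ (squareGF Ch f g).leg ≅
    u₅ ≫ (squareHG_F H Ch f g h).leg
  ω : u₄ ≫ (squareH_GF Ch f g h).leg ≫ (squareGF Ch f g).top ≅
    u₅ ≫ (squareHG_F H Ch f g h).top ≫ (squareGF Ch g h).leg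
  ω_eq : ω.hom ▷ g.den =
    (pastingOne (squareGF Ch f g).cell (squareHG_F H Ch f g h).cell γ).hom
  ρ : u₄ ≫ (squareH_GF Ch f g h).top ≅
    u₅ ≫ (squareHG_F H Ch f g h).top ≫ (squareGF Ch g h).top
  ρ_eq : ρ.hom ▷ h.den =
    (pastingTwo (squareH_GF Ch f g h).cell (squareGF Ch g h).cell ω).hom

variable {H Ch f g h} in
/-- The diagram `(A⁴, u⁴, u⁵, u ∘ γ, h ∘ ρ)` from `h ∘ (g ∘ f)` to `(h ∘ g) ∘ f`. -/
def AssocData.preCell (d : AssocData H Ch f g h) :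
    PreCell ((f.comp H Ch g).comp H Ch h) (f.comp H Ch (g.comp H Ch h)) where
  obj := d.obj
  v₁ := d.u₄
  v₂ := d.u₅
  mem := d.mem
  α := whiskerLeftIso d.u₄ (α_ (squareH_GF Ch f g h).leg (squareGF Ch f g).leg f.den).symm ≪≫
    (α_ d.u₄ ((squareH_GF Ch f g h).leg ≫ (squareGF Ch f g).leg) f.den).symm ≪≫
    whiskerRightIso d.γ f.den ≪≫ α_ d.u₅ (squareHG_F H Ch f g h).leg f.den
  β := (α_ d.u₄ (squareH_GF Ch f g h).top h.num).inv ≫ d.ρ.hom ▷ h.num ≫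
    (α_ d.u₅ ((squareHG_F H Ch f g h).top ≫ (squareGF Ch g h).top) h.num).hom ≫
    d.u₅ ◁ (α_ (squareHG_F H Ch f g h).top (squareGF Ch g h).top h.num).hom

/-- The data determined by the choices `C(W)` and `D(W)`: fill the cospan `(u¹ ∘ u², u³)` by the
chosen square, then lift along `v`, then lift along `w`. -/
noncomputable def AssocData.ofChoices (Dh : LiftChoices W) : AssocData H Ch f g h :=
  let s₁ := squareGF Ch f g
  let s₂ := squareH_GF Ch f g h
  let s₃ := squareGF Ch g h
  let s₄ := squareHG_F H Ch f g h
  let S : Square W (s₂.leg ≫ s₁.leg) s₄.leg := Ch.square (s₂.leg ≫ s₁.leg) s₄.leg s₄.leg_mem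
  let L := Dh.lift g.den g.den_mem (pastingOne s₁.cell s₄.cell S.cell).hom
  haveI : IsIso L.cell := Dh.isIso_cell g.den g.den_mem _
  let ω : (L.leg ≫ S.leg) ≫ s₂.leg ≫ s₁.top ≅ (L.leg ≫ S.top) ≫ s₄.top ≫ s₃.leg :=
    reassociate L.leg (asIso L.cell)
  let M := Dh.lift h.den h.den_mem (pastingTwo s₂.cell s₃.cell ω).hom
  haveI : IsIso M.cell := Dh.isIso_cell h.den h.den_mem _
  { obj := M.obj
    u₄ := M.leg ≫ L.leg ≫ S.leg
    mem := H.comp_mem _ _ (H.comp_mem _ _ M.leg_mem (H.comp_mem _ _ L.leg_mem S.leg_mem))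
      (H.comp_mem _ _ s₂.leg_mem (H.comp_mem _ _ s₁.leg_mem f.den_mem))
    u₅ := M.leg ≫ L.leg ≫ S.top
    γ := restrict M.leg (restrict L.leg S.cell)
    ω := restrict M.leg ω
    ω_eq := restrict_pastingOne s₁.cell s₄.cell (restrict L.leg S.cell) ω
      (reassociate_pastingOne s₁.cell s₄.cell S.cell L.leg (asIso L.cell) L.eq) M.leg
    ρ := reassociate M.leg (asIso M.cell)
    ρ_eq := reassociate_pastingTwo s₂.cell s₃.cell ω M.leg (asIso M.cell) M.eq }

/-- The associator `h ∘ (g ∘ f) ⟹ (h ∘ g) ∘ f` of the bicategory of fractions constructed from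
the choices `C(W)` and `D(W)`. -/
noncomputable def fracAssociator (Dh : LiftChoices W) :
    Cell ((f.comp H Ch g).comp H Ch h) (f.comp H Ch (g.comp H Ch h)) :=
  (AssocData.ofChoices H Ch f g h Dh).preCell.toCell

end Associator

section Explicit

variable {C : Type u} [Bicategory.{w, v} C]

/-- The 2-morphism `α : ((u ∘ id) ∘ id) ∘ u³ ⟹ (u ∘ u³) ∘ id`, composed of right unitors. -/
def explicitAlpha {A A' A₃ : C} (u : A' ⟶ A) (u₃ : A₃ ⟶ A') :
    u₃ ≫ 𝟙 A' ≫ 𝟙 A' ≫ u ≅ 𝟙 A₃ ≫ u₃ ≫ u :=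
  whiskerLeftIso u₃ (whiskerLeftIso (𝟙 A') (λ_ u)) ≪≫ whiskerLeftIso u₃ (λ_ u) ≪≫
    (λ_ (u₃ ≫ u)).symm

/-- The 2-morphism `β : (h ∘ (g ∘ f)) ∘ u³ ⟹ ((h ∘ g) ∘ f²) ∘ id`, composed of associators,
of `η : f ∘ u³ ⟹ (id ∘ id) ∘ f²` and of unitors. -/
def explicitBeta {A' A₃ B D E : C} (f : A' ⟶ B) (g : B ⟶ D) (h : D ⟶ E) (u₃ : A₃ ⟶ A')
    (f₂ : A₃ ⟶ B) (η : u₃ ≫ f ≅ f₂ ≫ 𝟙 B ≫ 𝟙 B) :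
    u₃ ≫ (f ≫ g) ≫ h ⟶ 𝟙 A₃ ≫ f₂ ≫ g ≫ h :=
  u₃ ◁ (α_ f g h).hom ≫ (α_ u₃ f (g ≫ h)).inv ≫ η.hom ▷ (g ≫ h) ≫
    (f₂ ◁ (ρ_ (𝟙 B)).hom) ▷ (g ≫ h) ≫ (ρ_ f₂).hom ▷ (g ≫ h) ≫ (λ_ (f₂ ≫ g ≫ h)).inv

variable {W : MorphismProperty C} (H : IsBicalculus W)

/-- The 1-morphism `(B, id_B, g)` of the bicategory of fractions. -/
def Frac.ofHom {B D : C} (g : B ⟶ D) : Frac W B D := ⟨B, 𝟙 B, H.id_mem B, g⟩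

/-- The triple `(A', (u ∘ id) ∘ id, h ∘ (g ∘ f))`. -/
def explicitSource {A A' B D E : C} (u : A' ⟶ A) (hu : W u) (f : A' ⟶ B) (g : B ⟶ D)
    (h : D ⟶ E) : Frac W A E where
  obj := A'
  den := 𝟙 A' ≫ 𝟙 A' ≫ u
  den_mem := H.comp_mem _ _ (H.id_mem A') (H.comp_mem _ _ (H.id_mem A') hu)
  num := (f ≫ g) ≫ h

/-- The triple `(A³, u ∘ u³, (h ∘ g) ∘ f²)`. -/
def explicitTarget {A A' A₃ B D E : C} (u : A' ⟶ A) (hu : W u) (u₃ : A₃ ⟶ A') (hu₃ : W u₃)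
    (f₂ : A₃ ⟶ B) (g : B ⟶ D) (h : D ⟶ E) : Frac W A E where
  obj := A₃
  den := u₃ ≫ u
  den_mem := H.comp_mem _ _ hu₃ hu
  num := f₂ ≫ g ≫ h

/-- The diagram `(A³, u³, id, α, β)`. -/
def explicitCell {A A' A₃ B D E : C} (u : A' ⟶ A) (hu : W u) (f : A' ⟶ B) (g : B ⟶ D)
    (h : D ⟶ E) (u₃ : A₃ ⟶ A') (hu₃ : W u₃) (f₂ : A₃ ⟶ B) (η : u₃ ≫ f ≅ f₂ ≫ 𝟙 B ≫ 𝟙 B) :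
    PreCell (explicitSource H u hu f g h) (explicitTarget H u hu u₃ hu₃ f₂ g h) where
  obj := A₃
  v₁ := u₃
  v₂ := 𝟙 A₃
  mem := H.comp_mem _ _ hu₃ (explicitSource H u hu f g h).den_mem
  α := explicitAlpha u u₃
  β := explicitBeta f g h u₃ f₂ η

end Explicit

end FracBicat

open FracBicat

namespace FracBicat

/-! ### The two compatibility equations when `g` and `h` have identity denominators -/

section Unital

variable {C : Type u} [Bicategory.{w, v} C]

/-! With unital choices, the squares for `g ∘ f`, `h ∘ (g ∘ f)` and `h ∘ g` have identity legs and
unitor cells, so the only nontrivial square left is `η`. The auxiliary data then amount to `u₄ : X ⟶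
A'`, `u₅ : X ⟶ A₃` and `γ`. Indeed `ω` and `ρ` are prescribed after whiskering with an identity, and
such whiskering is faithful (`eq_of_whiskerRight_id`); hence both are forced, up to coherence, to be
pastings of `γ` and `η`, however they were obtained.

The resulting diagram is compared with `(A₃, u₃, id, α, β)` over the vertex `X`, along `𝟙 X` and
`u₅`. The second comparison cell is made of unitors, the first is `γ⁻¹` up to unitors. In both
equations of `PreCell.Rel` this `γ⁻¹` cancels the `γ` of the data; what remains is the explicit `α`,
respectively `β`, restricted along `u₅` (`den_compatibility`, `num_compatibility`). -/

/-- The comparison `u³ ∘ u⁵ ⟹ u⁴ ∘ id` obtained by inverting `γ`. -/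
def invCompId {X A' A₃ : C} {u₃ : A₃ ⟶ A'} {u₄ : X ⟶ A'} {u₅ : X ⟶ A₃}
    (γ : u₄ ≫ 𝟙 A' ≫ 𝟙 A' ≅ u₅ ≫ u₃) : u₅ ≫ u₃ ≅ 𝟙 X ≫ u₄ :=
  γ.symm ≪≫ whiskerLeftIso u₄ (ρ_ (𝟙 A')) ≪≫ ρ_ u₄ ≪≫ (λ_ u₄).symm

/-- Whiskering with an identity is conjugation by right unitors. This makes lifts along `id` unique
and computable. -/
lemma eq_of_whiskerRight_id {X Y : C} {a b : X ⟶ Y} {ω : a ⟶ b} {φ : a ≫ 𝟙 Y ⟶ b ≫ 𝟙 Y}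
    (e : ω ▷ 𝟙 Y = φ) : ω = (ρ_ a).inv ≫ φ ≫ (ρ_ b).hom := by
  simp [← e]

/-- The equation on denominators in `PreCell.Rel`. Only `γ` and its inverse occur besides structural
cells. -/
lemma den_compatibility {A A' A₃ X : C} (u : A' ⟶ A) {u₃ : A₃ ⟶ A'} {u₄ : X ⟶ A'}
    {u₅ : X ⟶ A₃} (γ : u₄ ≫ 𝟙 A' ≫ 𝟙 A' ≅ u₅ ≫ u₃) :
    (α_ u₅ u₃ (𝟙 A' ≫ 𝟙 A' ≫ u)).inv ≫ (invCompId γ).hom ▷ (𝟙 A' ≫ 𝟙 A' ≫ u) ≫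
      (α_ (𝟙 X) u₄ (𝟙 A' ≫ 𝟙 A' ≫ u)).hom ≫
      𝟙 X ◁ (u₄ ◁ (α_ (𝟙 A') (𝟙 A') u).inv ≫ (α_ u₄ (𝟙 A' ≫ 𝟙 A') u).inv ≫
        γ.hom ▷ u ≫ (α_ u₅ u₃ u).hom) ≫
      (α_ (𝟙 X) u₅ (u₃ ≫ u)).inv ≫ ((λ_ u₅).hom ≫ (ρ_ u₅).inv) ▷ (u₃ ≫ u) ≫
      (α_ u₅ (𝟙 A₃) (u₃ ≫ u)).hom = u₅ ◁ (explicitAlpha u u₃).hom := by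
  -- By interchange with the unitors `(u ∘ id) ∘ id ⟹ u`, the cell `γ⁻¹` gets whiskered with `u`
  -- alone, as `γ` is in the other factor.
  have key : (invCompId γ).hom ▷ (𝟙 A' ≫ 𝟙 A' ≫ u) =
      (u₅ ≫ u₃) ◁ ((λ_ _).hom ≫ (λ_ _).hom) ≫ γ.inv ▷ u ≫
      ((u₄ ◁ (ρ_ (𝟙 A')).hom ≫ (ρ_ u₄).hom ≫ (λ_ u₄).inv) ▷ u) ≫
      (𝟙 X ≫ u₄) ◁ ((λ_ _).inv ≫ (λ_ _).inv) := by
    rw [← comp_whiskerRight_assoc]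
    have := whisker_exchange (invCompId γ).hom ((λ_ (𝟙 A' ≫ u)).hom ≫ (λ_ _).hom)
    change _ = _ ≫ (invCompId γ).hom ▷ u ≫ _
    rw [reassoc_of% this, ← Bicategory.whiskerLeft_comp]
    simp
  rw [key]
  -- All cells between `γ⁻¹` and `γ` are structural, so coherence makes the two adjacent; their
  -- composite is then replaced by an identity.
  have c : (γ.inv ▷ u) ≫ ((u₄ ◁ (ρ_ (𝟙 A')).hom ≫ (ρ_ u₄).hom ≫ (λ_ u₄).inv) ▷ u) ≫
      (𝟙 X ≫ u₄) ◁ ((λ_ (u)).inv ≫ (λ_ _).inv) ≫ (α_ (𝟙 X) u₄ (𝟙 A' ≫ 𝟙 A' ≫ u)).hom ≫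
      𝟙 X ◁ (u₄ ◁ (α_ (𝟙 A') (𝟙 A') u).inv ≫ (α_ u₄ (𝟙 A' ≫ 𝟙 A') u).inv ≫
        γ.hom ▷ u) = (λ_ _).inv ≫ 𝟙 _ ◁ (γ.inv ▷ u ≫ γ.hom ▷ u) := by
    bicategory
  rw [← comp_whiskerRight, γ.inv_hom_id] at c
  simp only [Bicategory.whiskerLeft_comp, Category.assoc] at c ⊢
  rw [reassoc_of% c]
  simp only [explicitAlpha]
  simp
  bicategory

/-- The equation on numerators in `PreCell.Rel`. Once `ρ` is solved for, it contains `γ` followed by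
`η`; `γ` cancels and `η` yields `explicitBeta`. -/
lemma num_compatibility {A' A₃ B D E X : C} (f : A' ⟶ B) (g : B ⟶ D) (h : D ⟶ E)
    {u₃ : A₃ ⟶ A'} {f₂ : A₃ ⟶ B} (η : u₃ ≫ f ≅ f₂ ≫ 𝟙 B ≫ 𝟙 B) {u₄ : X ⟶ A'}
    {u₅ : X ⟶ A₃} (γ : u₄ ≫ 𝟙 A' ≫ 𝟙 A' ≅ u₅ ≫ u₃) (ω : u₄ ≫ 𝟙 A' ≫ f ≅ u₅ ≫ f₂ ≫ 𝟙 B)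
    (hω : ω.hom ▷ 𝟙 B = (pastingOne (λ_ f ≪≫ (ρ_ f).symm) η γ).hom)
    (ρ : u₄ ≫ f ≫ g ≅ u₅ ≫ f₂ ≫ g)
    (hρ : ρ.hom ▷ 𝟙 D = (pastingTwo (λ_ (f ≫ g) ≪≫ (ρ_ (f ≫ g)).symm)
      (λ_ g ≪≫ (ρ_ g).symm) ω).hom) :
    (α_ u₅ u₃ ((f ≫ g) ≫ h)).inv ≫ (invCompId γ).hom ▷ ((f ≫ g) ≫ h) ≫
      (α_ (𝟙 X) u₄ ((f ≫ g) ≫ h)).hom ≫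
      𝟙 X ◁ ((α_ u₄ (f ≫ g) h).inv ≫ ρ.hom ▷ h ≫ (α_ u₅ (f₂ ≫ g) h).hom ≫
        u₅ ◁ (α_ f₂ g h).hom) ≫
      (α_ (𝟙 X) u₅ (f₂ ≫ g ≫ h)).inv ≫ ((λ_ u₅).hom ≫ (ρ_ u₅).inv) ▷ (f₂ ≫ g ≫ h) ≫
      (α_ u₅ (𝟙 A₃) (f₂ ≫ g ≫ h)).hom = u₅ ◁ explicitBeta f g h u₃ f₂ η := by
  have eω : ω.hom = u₄ ◁ (λ_ f).hom ≫ ((ρ_ u₄).inv ≫ u₄ ◁ (ρ_ (𝟙 A')).inv) ▷ f ≫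
      γ.hom ▷ f ≫ (α_ u₅ u₃ f).hom ≫ u₅ ◁ (η.hom ≫ f₂ ◁ (ρ_ (𝟙 B)).hom) := by
    rw [eq_of_whiskerRight_id hω]
    simp only [pastingOne, Iso.trans_hom, whiskerLeftIso_hom, whiskerRightIso_hom, Iso.symm_hom,
      Iso.trans_inv, Iso.symm_inv]
    bicategory
  have eρ : ρ.hom = (α_ u₄ f g).inv ≫ (u₄ ◁ (λ_ f).inv) ▷ g ≫ ω.hom ▷ g ≫
      (u₅ ◁ (ρ_ f₂).hom) ▷ g ≫ (α_ u₅ f₂ g).hom := by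
    rw [eq_of_whiskerRight_id hρ]
    simp only [pastingTwo, Iso.trans_hom, whiskerLeftIso_hom, whiskerRightIso_hom, Iso.symm_hom,
      Iso.trans_inv, Iso.symm_inv]
    bicategory
  rw [eρ, eω]
  -- `γ⁻¹` must be whiskered by `f`, `g`, `h` successively to meet `γ`, which reaches `ρ` through
  -- `ω` in that form.
  have split : γ.inv ▷ ((f ≫ g) ≫ h) =
      (α_ _ _ h).inv ≫ ((α_ _ f g).inv ≫ γ.inv ▷ f ▷ g ≫ (α_ _ f g).hom) ▷ h ≫
        (α_ _ _ h).hom := by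
    simp
  have cancel : γ.inv ▷ f ▷ g ▷ h ≫ γ.hom ▷ f ▷ g ▷ h = 𝟙 _ := by
    simp [← comp_whiskerRight]
  simp only [invCompId, Iso.trans_hom, Iso.symm_hom, comp_whiskerRight, split, Category.assoc,
    whiskerLeftIso_hom]
  have middle : γ.inv ▷ f ▷ g ▷ h ≫ ((α_ (u₄ ≫ 𝟙 A' ≫ 𝟙 A') f g).hom ▷ h ≫
      (α_ _ (f ≫ g) h).hom ≫ (u₄ ◁ (ρ_ (𝟙 A')).hom) ▷ ((f ≫ g) ≫ h) ≫
      (ρ_ u₄).hom ▷ ((f ≫ g) ≫ h) ≫ (λ_ u₄).inv ▷ ((f ≫ g) ≫ h) ≫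
      (α_ (𝟙 X) u₄ ((f ≫ g) ≫ h)).hom ≫ 𝟙 X ◁ ((α_ u₄ (f ≫ g) h).inv ≫
      ((α_ u₄ f g).inv ≫ (u₄ ◁ (λ_ f).inv) ▷ g ≫ (u₄ ◁ (λ_ f).hom) ▷ g ≫
      ((ρ_ u₄).inv ▷ f) ▷ g ≫ ((u₄ ◁ (ρ_ (𝟙 A')).inv) ▷ f) ▷ g) ▷ h ≫
      γ.hom ▷ f ▷ g ▷ h)) = (γ.inv ▷ f ▷ g ▷ h ≫ γ.hom ▷ f ▷ g ▷ h) ≫ (λ_ _).inv := by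
    bicategory
  rw [cancel] at middle
  simp only [comp_whiskerRight, Bicategory.whiskerLeft_comp, Category.assoc] at middle ⊢
  rw [reassoc_of% middle]
  simp only [explicitBeta, Bicategory.whiskerLeft_comp]
  bicategory

end Unital

/-! ### From equations between chosen squares to equality of classes -/

section Comparison

variable {C : Type u} [Bicategory.{w, v} C] {W : MorphismProperty C} (H : IsBicalculus W)

/-- The chosen square for a pair `(f, id)`, under the convention on choices. -/
def unitalSquare {X B : C} (f : X ⟶ B) : Square W f (𝟙 B) :=
  ⟨X, 𝟙 X, H.id_mem X, f, λ_ f ≪≫ (ρ_ f).symm⟩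

/-- The chosen squares equal the unital ones only propositionally, so they are variables here:
substitution turns the casts into identities. `HEq` is needed for `s₄`, whose type depends on
`s₃.leg`. -/
lemma toCell_cast_eq_explicitCell {A A' B D E A₃ : C} (u : A' ⟶ A) (hu : W u) (f : A' ⟶ B)
    (g : B ⟶ D) (h : D ⟶ E) (u₃ : A₃ ⟶ A') (hu₃ : W u₃) (f₂ : A₃ ⟶ B)
    (η : u₃ ≫ f ≅ f₂ ≫ 𝟙 B ≫ 𝟙 B)
    (s₁ : Square W f (𝟙 B)) (hs₁ : s₁ = unitalSquare H f)
    (s₂ : Square W (s₁.top ≫ g) (𝟙 D)) (hs₂ : s₂ = unitalSquare H (s₁.top ≫ g))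
    (s₃ : Square W g (𝟙 D)) (hs₃ : s₃ = unitalSquare H g)
    (s₄ : Square W f (s₃.leg ≫ 𝟙 B))
    (hs₄ : HEq s₄ (⟨A₃, u₃, hu₃, f₂, η⟩ : Square W f (𝟙 B ≫ 𝟙 B)))
    {X : C} (u₄ : X ⟶ s₂.obj) (hu₄ : W (u₄ ≫ s₂.leg ≫ s₁.leg ≫ u)) (u₅ : X ⟶ s₄.obj)
    (γ : u₄ ≫ s₂.leg ≫ s₁.leg ≅ u₅ ≫ s₄.leg)
    (ω : u₄ ≫ s₂.leg ≫ s₁.top ≅ u₅ ≫ s₄.top ≫ s₃.leg)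
    (hω : ω.hom ▷ 𝟙 B = (pastingOne s₁.cell s₄.cell γ).hom)
    (ρ : u₄ ≫ s₂.top ≅ u₅ ≫ s₄.top ≫ s₃.top)
    (hρ : ρ.hom ▷ 𝟙 D = (pastingTwo s₂.cell s₃.cell ω).hom)
    (m₁ : W (s₂.leg ≫ s₁.leg ≫ u)) (m₂ : W (s₄.leg ≫ u))
    (e₁ : Frac.mk s₂.obj (s₂.leg ≫ s₁.leg ≫ u) m₁ (s₂.top ≫ h) = explicitSource H u hu f g h)
    (e₂ : Frac.mk s₄.obj (s₄.leg ≫ u) m₂ (s₄.top ≫ s₃.top ≫ h) =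
      explicitTarget H u hu u₃ hu₃ f₂ g h) :
    (PreCell.toCell (f₁ := Frac.mk s₂.obj (s₂.leg ≫ s₁.leg ≫ u) m₁ (s₂.top ≫ h))
      (f₂ := Frac.mk s₄.obj (s₄.leg ≫ u) m₂ (s₄.top ≫ s₃.top ≫ h))
      { obj := X
        v₁ := u₄
        v₂ := u₅
        mem := hu₄
        α := whiskerLeftIso u₄ (α_ s₂.leg s₁.leg u).symm ≪≫
          (α_ u₄ (s₂.leg ≫ s₁.leg) u).symm ≪≫ whiskerRightIso γ u ≪≫ α_ u₅ s₄.leg u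
        β := (α_ u₄ s₂.top h).inv ≫ ρ.hom ▷ h ≫ (α_ u₅ (s₄.top ≫ s₃.top) h).hom ≫
          u₅ ◁ (α_ s₄.top s₃.top h).hom }).cast e₁ e₂ =
      (explicitCell H u hu f g h u₃ hu₃ f₂ η).toCell := by
  subst hs₁ hs₂ hs₃
  obtain rfl := eq_of_heq hs₄
  -- The explicit diagram has vertex `A₃` and second leg `id`, so `u₅` is the natural map from `X`
  -- to it.
  refine Quot.sound ⟨X, 𝟙 X, u₅, invCompId γ, λ_ u₅ ≪≫ (ρ_ u₅).symm, ?_, ?_, ?_⟩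
  · exact H.iso_mem _ _ hu₄ ⟨λ_ _⟩
  · exact den_compatibility u γ
  · exact num_compatibility f g h η γ ω hω ρ hρ

end Comparison

end FracBicat

open FracBicat
theorem mainTheorem11 {C : Type u} [Bicategory.{w, v} C] (W : MorphismProperty C)
    (H : IsBicalculus W) (Ch : SquareChoices W) (hCh : Ch.IsUnital H)
    {A A' B D E : C} (u : A' ⟶ A) (hu : W u) (f : A' ⟶ B) (g : B ⟶ D) (h : D ⟶ E)
    (A₃ : C) (u₃ : A₃ ⟶ A') (hu₃ : W u₃) (f₂ : A₃ ⟶ B) (η : u₃ ≫ f ≅ f₂ ≫ 𝟙 B ≫ 𝟙 B)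
    (hη : Ch.square f (𝟙 B ≫ 𝟙 B) (H.comp_mem _ _ (H.id_mem B) (H.id_mem B)) =
      ⟨A₃, u₃, hu₃, f₂, η⟩) :
    ∃ (e₁ : ((Frac.mk A' u hu f).comp H Ch (Frac.ofHom H g)).comp H Ch (Frac.ofHom H h) =
          explicitSource H u hu f g h)
      (e₂ : (Frac.mk A' u hu f).comp H Ch ((Frac.ofHom H g).comp H Ch (Frac.ofHom H h)) =
          explicitTarget H u hu u₃ hu₃ f₂ g h),
      (∀ Dh : LiftChoices W,
        (fracAssociator H Ch (Frac.mk A' u hu f) (Frac.ofHom H g) (Frac.ofHom H h) Dh).cast e₁ e₂ =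
          (explicitCell H u hu f g h u₃ hu₃ f₂ η).toCell) ∧
      (∀ d : AssocData H Ch (Frac.mk A' u hu f) (Frac.ofHom H g) (Frac.ofHom H h),
        d.preCell.toCell.cast e₁ e₂ = (explicitCell H u hu f g h u₃ hu₃ f₂ η).toCell) := by
  have comp_ofHom : ∀ {X Y Z : C} (p : Frac W X Y) (q : Y ⟶ Z), p.comp H Ch (Frac.ofHom H q) =
      ⟨p.obj, 𝟙 p.obj ≫ p.den, H.comp_mem _ _ (H.id_mem _) p.den_mem, p.num ≫ q⟩ := by
    intro X Y Z p q
    have key : ∀ s : Square W p.num (𝟙 Y), s = unitalSquare H p.num →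
        ∀ m, Frac.mk s.obj (s.leg ≫ p.den) m (s.top ≫ q) =
          ⟨p.obj, 𝟙 p.obj ≫ p.den, H.comp_mem _ _ (H.id_mem _) p.den_mem, p.num ≫ q⟩ := by
      rintro _ rfl m
      rfl
    exact key _ (hCh p.num) _
  have e₁ : ((Frac.mk A' u hu f).comp H Ch (Frac.ofHom H g)).comp H Ch (Frac.ofHom H h) =
      explicitSource H u hu f g h := by
    rw [comp_ofHom, comp_ofHom]
    rfl
  have e₂ : (Frac.mk A' u hu f).comp H Ch ((Frac.ofHom H g).comp H Ch (Frac.ofHom H h)) =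
      explicitTarget H u hu u₃ hu₃ f₂ g h := by
    rw [comp_ofHom]
    have key : ∀ s : Square W f (𝟙 B ≫ 𝟙 B), s = ⟨A₃, u₃, hu₃, f₂, η⟩ →
        ∀ m, Frac.mk s.obj (s.leg ≫ u) m (s.top ≫ g ≫ h) =
          explicitTarget H u hu u₃ hu₃ f₂ g h := by
      rintro _ rfl m
      rfl
    exact key _ hη _
  -- Replacing the leg of the square for `h ∘ g` by `𝟙 B` turns the cospan defining `u³` into the
  -- one of `hη`.
  have square_heq : ∀ s : Square W g (𝟙 D), s = unitalSquare H g → ∀ m,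
      HEq (Ch.square f (s.leg ≫ 𝟙 B) m)
        (⟨A₃, u₃, hu₃, f₂, η⟩ : Square W f (𝟙 B ≫ 𝟙 B)) := by
    rintro _ rfl m
    exact heq_of_eq hη
  have all : ∀ d : AssocData H Ch (Frac.mk A' u hu f) (Frac.ofHom H g) (Frac.ofHom H h),
      d.preCell.toCell.cast e₁ e₂ = (explicitCell H u hu f g h u₃ hu₃ f₂ η).toCell := fun d =>
    toCell_cast_eq_explicitCell H u hu f g h u₃ hu₃ f₂ η _ (hCh f) _ (hCh _) _ (hCh g) _
      (square_heq _ (hCh g) _) d.u₄ d.mem d.u₅ d.γ d.ω d.ω_eq d.ρ d.ρ_eq _ _ e₁ e₂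
  -- The associator computed from `D(W)` is by definition the class of one particular `AssocData`.
  exact ⟨e₁, e₂, fun Dh => all _, all⟩
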